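/- For a nonnegative integer $n$, a complete signed graph on the vertex set $V=\{0,\dots,n-1\}$ is $G=(V,E^+\cup E^-)$ where every pair of distinct vertices is joined by exactly one edge, labelled either '$+$' (an edge of $E^+$) or '$-$' (an edge of $E^-$). $G$ is \emph{balanced} if every triangle has an even number of '$-$' edges (equivalently, $V$ has a bipartition, possibly with an empty part, such that the '$+$' edges are exactly those inside the parts and the '$-$' edges exactly those across). A stream of $G$ lists every edge of $G$ exactly once together with its sign, in an arbitrary order. \textbf{Theorem.} There is a randomized single-pass streaming algorithm (one fixed program, for all $n$, which is given $n$, reads the stream once, and may draw independent fair random bits) that decides with $O(\log n)$ bits of space whether a complete signed graph is balanced, with the following guarantees, for every $n$, every complete signed graph $G$ on $n$ vertices and every stream of $G$: \begin{itemize} \item whatever its random bits are, the algorithm halts, and for $n\ge 2$ it never holds more than $C\log n$ bits in memory, where $C$ is an absolute constant; the memory includes $n$, the current edge, all random bits that are kept, and all intermediate results of the computation; \item if $G$ is balanced, the algorithm always outputs \textsc{Balanced}; \item if $G$ is not balanced, the algorithm outputs \textsc{NotBalanced} with probability at least $\frac{99}{100}$ over its random bits. \end{itemize} Here the algorithm is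 a program of a register machine with a fixed number of registers holding natural numbers, with assignment of constants, addition, truncated subtraction, multiplication, integer division and remainder of registers (with $a/0=0$ and $a \bmod 0=a$), branching and looping on whether a register is nonzero, an instruction that reads the next stream item, and an instruction that draws a random bit; its space is the maximum over the run of the total binary length of the register contents. -/

import Mathlib

namespace SignedStream

/-! ### Complete signed graphs and structural balance -/

/-- A complete signed graph `(V, E⁺ ∪ E⁻)`: every pair of distinct vertices is joined by exactly
one edge, which is either a plus edge or a minus edge. -/
structure CompleteSignedGraph (V : Type*) where
  /-- the graph `(V, E⁺)` of plus edges -/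
  pos : SimpleGraph V
  /-- the graph `(V, E⁻)` of minus edges -/
  neg : SimpleGraph V
  /-- `E⁺` and `E⁻` are disjoint, and together they are all the edges -/
  isCompl : IsCompl pos neg

open Classical in
/-- The number of minus edges (zero or one) between `u` and `v`. -/
noncomputable def CompleteSignedGraph.negCount {V : Type*} (G : CompleteSignedGraph V)
    (u v : V) : ℕ :=
  if G.neg.Adj u v then 1 else 0

/-- Structural balance: every triangle has an even number of minus edges. -/
def CompleteSignedGraph.IsBalanced {V : Type*} (G : CompleteSignedGraph V) : Prop :=
  ∀ u v w : V, u ≠ v → v ≠ w → u ≠ w →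
    Even (G.negCount u v + G.negCount v w + G.negCount u w)

theorem CompleteSignedGraph.pos_adj_iff {V : Type*} (G : CompleteSignedGraph V) (u v : V) :
    G.pos.Adj u v ↔ u ≠ v ∧ ¬ G.neg.Adj u v := by
  rw [G.isCompl.eq_compl, SimpleGraph.compl_adj]

/-- Balance is the same as the existence of a bipartition `(L, V \ L)` (a part may be empty) such
that the plus edges are inside the parts and the minus edges are across. -/
theorem CompleteSignedGraph.isBalanced_iff_exists_partition {V : Type*}
    (G : CompleteSignedGraph V) :
    G.IsBalanced ↔ ∃ L : Set V, (∀ u v, G.pos.Adj u v → (u ∈ L ↔ v ∈ L)) ∧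
      (∀ u v, G.neg.Adj u v → (u ∈ L ↔ v ∉ L)) := by
  classical
  constructor
  · intro h
    rcases isEmpty_or_nonempty V with hV | ⟨⟨a⟩⟩
    · exact ⟨∅, fun u => (hV.false u).elim, fun u => (hV.false u).elim⟩
    have key : ∀ u v, u ≠ v → (G.neg.Adj u v ↔ ¬ (G.neg.Adj a u ↔ G.neg.Adj a v)) := by
      intro u v huv
      by_cases hu : a = u
      · subst hu; simp
      by_cases hv : a = v
      · subst hv; simp [G.neg.adj_comm u a]
      have := h a u v hu huv hv
      unfold negCount at this
      by_cases h1 : G.neg.Adj a u <;> by_cases h2 : G.neg.Adj u v <;>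
        by_cases h3 : G.neg.Adj a v <;> simp_all [Nat.even_iff]
    refine ⟨{v | G.neg.Adj a v}, fun u v huv => ?_, fun u v huv => ?_⟩
    · have h1 := (G.pos_adj_iff u v).1 huv
      have := key u v h1.1
      simp only [Set.mem_ofPred_eq]; tauto
    · have := key u v huv.ne
      simp only [Set.mem_ofPred_eq]; tauto
  · rintro ⟨L, hp, hn⟩ u v w huv hvw huw
    have key : ∀ x y, x ≠ y → (G.neg.Adj x y ↔ (x ∈ L ↔ y ∉ L)) := by
      intro x y hxy
      refine ⟨hn x y, fun hL => ?_⟩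
      by_contra hc
      have := hp x y ((G.pos_adj_iff x y).2 ⟨hxy, hc⟩)
      tauto
    unfold negCount
    rw [if_congr (key u v huv) rfl rfl, if_congr (key v w hvw) rfl rfl,
      if_congr (key u w huw) rfl rfl]
    by_cases h1 : u ∈ L <;> by_cases h2 : v ∈ L <;> by_cases h3 : w ∈ L <;>
      simp [h1, h2, h3]

/-! ### Edge streams -/

/-- The sign of an edge. -/
inductive Sign
  | plus
  | minus

/-- One item of a graph stream on the vertex set `{0, …, n - 1}`: an edge and its sign. -/
structure Item (n : ℕ) where
  u : Fin n
  v : Fin n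
  sign : Sign

/-- The unordered pair of end points of a stream item. -/
def Item.edge {n : ℕ} (t : Item n) : Sym2 (Fin n) := s(t.u, t.v)

/-- An item as an algorithm sees it: two vertex names and a sign (`0` for plus, `1` for minus). -/
def Item.encode {n : ℕ} (t : Item n) : ℕ × ℕ × ℕ :=
  (t.u, t.v, match t.sign with | .plus => 0 | .minus => 1)

/-- `l` is a stream of the complete signed graph `G`: it lists every edge exactly once, with its
sign; the order of the edges, and of the two end points of an edge, is arbitrary. -/
structure CompleteSignedGraph.IsStream {n : ℕ} (G : CompleteSignedGraph (Fin n))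
    (l : List (Item n)) : Prop where
  sign_correct : ∀ t ∈ l, match t.sign with
    | .plus => G.pos.Adj t.u t.v
    | .minus => G.neg.Adj t.u t.v
  exactly_once : ∀ u v : Fin n, u ≠ v → (l.map Item.edge).count s(u, v) = 1

/-! ### Randomized single-pass streaming algorithms and their space

The algorithms are programs of a register machine: a fixed finite program (independent of the
input and of `n`) with a fixed number `k` of registers that hold natural numbers. Besides its
registers it has a read-once stream of edges and a read-once source of random bits. Its space is
the total number of bits in the registers, at the worst moment of the computation. So everything
that is to be remembered (`n`, the current edge, random bits, all intermediate results) is paid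
for. -/

/-- Arithmetic of the machine (subtraction is truncated, quotients are rounded down, and
`a / 0 = 0`, `a % 0 = a`). -/
inductive Op
  | add
  | sub
  | mul
  | div
  | mod

/-- The value of an arithmetic operation. -/
def Op.eval : Op → ℕ → ℕ → ℕ
  | .add, a, b => a + b
  | .sub, a, b => a - b
  | .mul, a, b => a * b
  | .div, a, b => a / b
  | .mod, a, b => a % b

/-- The instructions of a machine with `k` registers. -/
inductive Instr (k : ℕ)
  /-- `x := c`, for a constant `c` -/
  | const (x : Fin k) (c : ℕ)
  /-- `x := y op z` -/
  | arith (o : Op) (x y z : Fin k)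
  /-- put a fresh random bit into `x` -/
  | flip (x : Fin k)
  /-- read the next item of the stream: `u`, `v`, `s` receive the end points and the sign, and
  `e := 1`; if the stream is exhausted, only `e := 0` -/
  | read (u v s e : Fin k)

/-- Programs over `k` registers. -/
inductive Prog (k : ℕ)
  | instr (i : Instr k)
  | seq (p q : Prog k)
  /-- if register `x` is nonzero then `p` else `q` -/
  | cond (x : Fin k) (p q : Prog k)
  /-- while register `x` is nonzero do `p` -/
  | loop (x : Fin k) (p : Prog k)

/-- A configuration: the registers, the unread part of the stream, the unused random bits. -/
structure State (k : ℕ) where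
  reg : Fin k → ℕ
  input : List (ℕ × ℕ × ℕ)
  coins : ℕ → Bool

/-- The number of bits in memory: the binary lengths of the register contents (`0` takes one
bit). -/
def State.bits {k : ℕ} (σ : State k) : ℕ := ∑ i, max 1 (Nat.size (σ.reg i))

/-- `x := a`. -/
def State.set {k : ℕ} (σ : State k) (x : Fin k) (a : ℕ) : State k :=
  { σ with reg := Function.update σ.reg x a }

/-- The effect of an instruction. -/
def Instr.apply {k : ℕ} : Instr k → State k → State k
  | .const x c, σ => σ.set x c
  | .arith o x y z, σ => σ.set x (o.eval (σ.reg y) (σ.reg z))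
  | .flip x, σ => { σ.set x (σ.coins 0).toNat with coins := fun i => σ.coins (i + 1) }
  | .read u v s e, σ =>
    match σ.input with
    | [] => σ.set e 0
    | (a, b, c) :: rest =>
      { (((σ.set u a).set v b).set s c).set e 1 with input := rest }

/-- `Exec p σ τ m`: the program `p`, started in `σ`, halts in `τ`, and `m` is the largest number
of bits in memory at any moment of the run. -/
inductive Exec {k : ℕ} : Prog k → State k → State k → ℕ → Prop
  | instr (i : Instr k) (σ : State k) :
      Exec (.instr i) σ (i.apply σ) (max σ.bits (i.apply σ).bits)
  | seq {p q : Prog k} {σ τ ρ : State k} {a b : ℕ} :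
      Exec p σ τ a → Exec q τ ρ b → Exec (.seq p q) σ ρ (max a b)
  | cond_true {x : Fin k} {p q : Prog k} {σ τ : State k} {a : ℕ} :
      σ.reg x ≠ 0 → Exec p σ τ a → Exec (.cond x p q) σ τ a
  | cond_false {x : Fin k} {p q : Prog k} {σ τ : State k} {a : ℕ} :
      σ.reg x = 0 → Exec q σ τ a → Exec (.cond x p q) σ τ a
  | loop_stop {x : Fin k} {p : Prog k} {σ : State k} :
      σ.reg x = 0 → Exec (.loop x p) σ σ σ.bits
  | loop_step {x : Fin k} {p : Prog k} {σ τ ρ : State k} {a b : ℕ} :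
      σ.reg x ≠ 0 → Exec p σ τ a → Exec (.loop x p) τ ρ b → Exec (.loop x p) σ ρ (max a b)

/-- A run is determined by its initial configuration. -/
theorem Exec.unique {k : ℕ} {p : Prog k} {σ τ : State k} {m : ℕ} (h : Exec p σ τ m) :
    ∀ {τ' : State k} {m' : ℕ}, Exec p σ τ' m' → τ = τ' ∧ m = m' := by
  induction h with
  | instr i σ => intro τ' m' h'; cases h'; exact ⟨rfl, rfl⟩
  | seq _ _ ih1 ih2 =>
    intro τ' m' h'
    cases h' with
    | seq h1 h2 =>
      obtain ⟨rfl, rfl⟩ := ih1 h1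
      obtain ⟨rfl, rfl⟩ := ih2 h2
      exact ⟨rfl, rfl⟩
  | cond_true hx _ ih =>
    intro τ' m' h'
    cases h' with
    | cond_true _ h1 => exact ih h1
    | cond_false h0 _ => exact absurd h0 hx
  | cond_false hx _ ih =>
    intro τ' m' h'
    cases h' with
    | cond_true h0 _ => exact absurd hx h0
    | cond_false _ h1 => exact ih h1
  | loop_stop hx =>
    intro τ' m' h'
    cases h' with
    | loop_stop _ => exact ⟨rfl, rfl⟩
    | loop_step h0 _ _ => exact absurd hx h0
  | loop_step hx _ _ ih1 ih2 =>
    intro τ' m' h'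
    cases h' with
    | loop_stop h0 => exact absurd h0 hx
    | loop_step _ h1 h2 =>
      obtain ⟨rfl, rfl⟩ := ih1 h1
      obtain ⟨rfl, rfl⟩ := ih2 h2
      exact ⟨rfl, rfl⟩

/-- A randomized single-pass streaming algorithm: a program, the register that initially holds the
number `n` of vertices, and the register that holds the answer at the end. -/
structure StreamAlg where
  k : ℕ
  nReg : Fin k
  outReg : Fin k
  prog : Prog k

/-- The two answers. -/
inductive Verdict
  | balanced
  | notBalanced

/-- The answer in a register: `0` for not balanced, anything else for balanced. -/
def Verdict.ofNat : ℕ → Verdict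
  | 0 => .notBalanced
  | _ + 1 => .balanced

/-- The initial configuration: `n` in its register, `0` in all others. -/
def StreamAlg.init (A : StreamAlg) {n : ℕ} (l : List (Item n)) (ω : ℕ → Bool) : State A.k where
  reg := Function.update (fun _ => 0) A.nReg n
  input := l.map Item.encode
  coins := ω

/-- With the random bits `ω`, the algorithm `A` halts on the stream `l`, outputs `a`, and uses
exactly `m` bits of space. -/
def StreamAlg.Run (A : StreamAlg) {n : ℕ} (l : List (Item n)) (ω : ℕ → Bool) (a : Verdict)
    (m : ℕ) : Prop :=
  ∃ τ : State A.k, Exec A.prog (A.init l ω) τ m ∧ Verdict.ofNat (τ.reg A.outReg) = a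

/-- With the random bits `ω`, the algorithm `A` halts on the stream `l` and outputs `a`. -/
def StreamAlg.Outputs (A : StreamAlg) {n : ℕ} (l : List (Item n)) (ω : ℕ → Bool)
    (a : Verdict) : Prop :=
  ∃ m, A.Run l ω a m

/-- The law of a sequence of independent fair random bits. -/
noncomputable def coinMeasure : MeasureTheory.Measure (ℕ → Bool) :=
  MeasureTheory.Measure.infinitePi fun _ => (PMF.uniformOfFintype Bool).toMeasure

end SignedStream

namespace SignedStream

/-! Give the sign matrix `M` ones on the diagonal and let `r` be its row at vertex `0`. The graph is
balanced exactly when `M` is the rank-one matrix with entries `r u * r v`. The polynomial with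
coefficient `M u v - r u * r v` at `x ^ (u + n * v)` has at most one matrix entry per monomial, so
over a field of odd characteristic it is nonzero for an unbalanced graph and has at most `n ^ 2`
roots (`exists_roots`); for a balanced graph it is identically zero. A random `x` among at least
`100 * n ^ 2` distinct residues therefore exposes imbalance with probability at least 99/100.

With `y = x ^ n` the value at `x` is the form of `M` at `(x, y)` minus the product of the first-row
forms at `x` and at `y`. Each of these three forms is linear in `M`, so it is a fixed diagonal part
plus one term per edge, in any order (`form_eq`): three residues are all that must be accumulated.

By Bertrand's postulate the prime modulus is `O(n ^ 2)`. All 27 registers then stay below `maxValue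
n`, a polynomial in `n`, which gives `O(log n)` bits. The relation `Runs W` carries this bound
together with termination, so the program is verified piece by piece. -/

variable {k : ℕ}

/-! ### Space-bounded execution -/

/-- Every register content is at most `W`. -/
def State.Fits (W : ℕ) (σ : State k) : Prop := ∀ i, σ.reg i ≤ W

/-- Started in `σ` with register contents at most `W`, the program `p` halts in `τ`, and its
register contents never exceed `W`. -/
def Runs (W : ℕ) (p : Prog k) (σ τ : State k) : Prop :=
  σ.Fits W → τ.Fits W ∧ ∃ m, Exec p σ τ m ∧ m ≤ k * (W.size + 1)

theorem State.Fits.bits_le {W : ℕ} {σ : State k} (h : σ.Fits W) : σ.bits ≤ k * (W.size + 1) := by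
  calc σ.bits ≤ ∑ _i : Fin k, (W.size + 1) :=
        Finset.sum_le_sum fun i _ => by have := Nat.size_le_size (h i); omega
    _ = k * (W.size + 1) := by simp

/-- The values that the instruction `i` writes in `σ` are at most `W`. -/
def Instr.Small (W : ℕ) : Instr k → State k → Prop
  | .const _ c, _ => c ≤ W
  | .arith o _ y z, σ => o.eval (σ.reg y) (σ.reg z) ≤ W
  | .flip _, _ => 1 ≤ W
  | .read _ _ _ _, σ => 1 ≤ W ∧ ∀ t ∈ σ.input.head?, t.1 ≤ W ∧ t.2.1 ≤ W ∧ t.2.2 ≤ W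

theorem State.Fits.set {W a : ℕ} {σ : State k} (h : σ.Fits W) (x : Fin k) (ha : a ≤ W) :
    (σ.set x a).Fits W := by
  intro i
  by_cases hi : i = x
  · subst hi; simpa [State.set] using ha
  · simpa [State.set, hi] using h i

theorem State.Fits.apply {W : ℕ} {σ : State k} (h : σ.Fits W) {i : Instr k} (hi : i.Small W σ) :
    (i.apply σ).Fits W := by
  cases i with
  | const x c => exact h.set x hi
  | arith o x y z => exact h.set x hi
  | flip x => exact h.set x ((Bool.toNat_le _).trans hi)
  | read u v s e =>
    obtain ⟨h1, h2⟩ := hi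
    rcases hl : σ.input with _ | ⟨⟨a, b, c⟩, rest⟩
    · simpa only [Instr.apply, hl] using h.set e (Nat.zero_le _)
    · rw [hl] at h2
      have h3 := h2 (a, b, c) rfl
      simpa only [Instr.apply, hl, State.Fits] using (((h.set u h3.1).set v h3.2.1).set s h3.2.2).set e h1

theorem Runs.instr {W : ℕ} {σ : State k} {i : Instr k} (hi : i.Small W σ) :
    Runs W (.instr i) σ (i.apply σ) := fun h =>
  ⟨h.apply hi, _, .instr i σ, max_le h.bits_le (h.apply hi).bits_le⟩

theorem Runs.seq {W : ℕ} {σ τ ρ : State k} {p q : Prog k} (hp : Runs W p σ τ)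
    (hq : Runs W q τ ρ) : Runs W (.seq p q) σ ρ := fun h => by
  obtain ⟨h1, a, ha, ha'⟩ := hp h
  obtain ⟨h2, b, hb, hb'⟩ := hq h1
  exact ⟨h2, _, .seq ha hb, max_le ha' hb'⟩

theorem Runs.cond_true {W : ℕ} {σ τ : State k} {x : Fin k} {p q : Prog k} (hx : σ.reg x ≠ 0)
    (hp : Runs W p σ τ) : Runs W (.cond x p q) σ τ := fun h => by
  obtain ⟨h1, a, ha, ha'⟩ := hp h
  exact ⟨h1, _, .cond_true hx ha, ha'⟩

theorem Runs.cond_false {W : ℕ} {σ τ : State k} {x : Fin k} {p q : Prog k} (hx : σ.reg x = 0)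
    (hq : Runs W q σ τ) : Runs W (.cond x p q) σ τ := fun h => by
  obtain ⟨h1, a, ha, ha'⟩ := hq h
  exact ⟨h1, _, .cond_false hx ha, ha'⟩

theorem Runs.loop_stop {W : ℕ} {σ : State k} {x : Fin k} {p : Prog k} (hx : σ.reg x = 0) :
    Runs W (.loop x p) σ σ := fun h => ⟨h, _, Exec.loop_stop hx, h.bits_le⟩

theorem Runs.loop_step {W : ℕ} {σ τ ρ : State k} {x : Fin k} {p : Prog k} (hx : σ.reg x ≠ 0)
    (hp : Runs W p σ τ) (hq : Runs W (.loop x p) τ ρ) : Runs W (.loop x p) σ ρ := fun h => by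
  obtain ⟨h1, a, ha, ha'⟩ := hp h
  obtain ⟨h2, b, hb, hb'⟩ := hq h1
  exact ⟨h2, _, .loop_step hx ha hb, max_le ha' hb'⟩

/-- Total correctness of a loop: an invariant `I` and a natural number that decreases. -/
theorem Runs.loop_of_measure {W : ℕ} {x : Fin k} {p : Prog k} (I : State k → Prop)
    (μ : State k → ℕ)
    (step : ∀ σ, I σ → σ.reg x ≠ 0 → ∃ τ, Runs W p σ τ ∧ I τ ∧ μ τ < μ σ) (σ : State k)
    (hσ : I σ) : ∃ τ, Runs W (.loop x p) σ τ ∧ I τ ∧ τ.reg x = 0 := by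
  induction hm : μ σ using Nat.strong_induction_on generalizing σ with
  | _ m ih =>
    by_cases hx : σ.reg x = 0
    · exact ⟨σ, Runs.loop_stop hx, hσ, hx⟩
    · obtain ⟨τ, h1, h2, h3⟩ := step σ hσ hx
      obtain ⟨ρ, h4, h5⟩ := ih (μ τ) (hm ▸ h3) τ h2 rfl
      exact ⟨ρ, h1.loop_step hx h4, h5⟩

/-! ### Straight-line code -/

/-- A nonempty sequence of instructions. -/
def block : Instr k → List (Instr k) → Prog k
  | i, [] => .instr i
  | i, j :: js => .seq (.instr i) (block j js)

/-- The effect of a sequence of instructions. -/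
def applyAll : List (Instr k) → State k → State k
  | [], σ => σ
  | i :: is, σ => applyAll is (i.apply σ)

/-- All values written by a sequence of instructions are at most `W`. -/
def AllSmall (W : ℕ) : List (Instr k) → State k → Prop
  | [], _ => True
  | i :: is, σ => i.Small W σ ∧ AllSmall W is (i.apply σ)

theorem Runs.block {W : ℕ} {σ : State k} {i : Instr k} {is : List (Instr k)}
    (h : AllSmall W (i :: is) σ) : Runs W (block i is) σ (applyAll (i :: is) σ) := by
  induction is generalizing i σ with
  | nil => exact Runs.instr h.1
  | cons j js ih => exact (Runs.instr h.1).seq (ih h.2)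

@[simp] theorem State.set_reg (σ : State k) (x : Fin k) (a : ℕ) (i : Fin k) :
    (σ.set x a).reg i = if i = x then a else σ.reg i := by
  simp [State.set, Function.update_apply]

@[simp] theorem State.set_input (σ : State k) (x : Fin k) (a : ℕ) :
    (σ.set x a).input = σ.input := rfl

@[simp] theorem State.set_coins (σ : State k) (x : Fin k) (a : ℕ) :
    (σ.set x a).coins = σ.coins := rfl

theorem State.ext' {σ τ : State k} (h1 : ∀ i, σ.reg i = τ.reg i) (h2 : σ.input = τ.input)
    (h3 : σ.coins = τ.coins) : σ = τ := by
  cases σ; cases τ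
  simp only [State.mk.injEq] at *
  exact ⟨funext h1, h2, h3⟩

/-! ### Horner's scheme -/

/-- `r := r₀`, and then `r := (r * b + a) mod p` as often as register `e` says. -/
def horner (one p zero : Fin k) (r₀ : ℕ) (b a e r c : Fin k) : Prog k :=
  .seq (block (.const r r₀) [.arith .add c zero e])
    (.loop c (block (.arith .mul r r b)
      [.arith .add r r a, .arith .mod r r p, .arith .sub c c one]))

/-- Reducing modulo `p` in every round keeps the accumulator below `p`, so no intermediate value
exceeds `p * b + a`. The case `a = 0`, `r₀ = 1` gives powers; `a = 1`, `r₀ = 0` gives the geometric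
sum for the diagonal. -/
theorem runs_horner {W : ℕ} {one p zero b a e r c : Fin k} {r₀ : ℕ} {σ : State k}
    (hr : r ∉ [one, p, zero, b, a, e, c]) (hc : c ∉ [one, p, zero, b, a, e])
    (hone : σ.reg one = 1) (hzero : σ.reg zero = 0) (hp : 0 < σ.reg p) (he : σ.reg e ≤ W)
    (hr₀ : r₀ < σ.reg p) (hW : σ.reg p * σ.reg b + σ.reg a + σ.reg p ≤ W) :
    ∃ v, Runs W (horner one p zero r₀ b a e r c) σ ((σ.set r v).set c 0) ∧ v < σ.reg p ∧
      (v : ZMod (σ.reg p)) = r₀ * (σ.reg b : ZMod (σ.reg p)) ^ σ.reg e +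
        σ.reg a * ∑ i ∈ Finset.range (σ.reg e), (σ.reg b : ZMod (σ.reg p)) ^ i := by
  simp only [List.mem_cons, List.not_mem_nil, or_false, not_or] at hr hc
  obtain ⟨hr1, hr2, hr3, hr4, hr5, hr6, hr7⟩ := hr
  obtain ⟨hc1, hc2, hc3, hc4, hc5, hc6⟩ := hc
  -- Both orientations of every inequality are collected, so that `simp` can evaluate each register
  -- after an update.
  have ne := And.intro (⟨hr1, hr2, hr3, hr4, hr5, hr6, hr7⟩ : _ ∧ _ ∧ _ ∧ _ ∧ _ ∧ _ ∧ _) <|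
    And.intro (⟨hc1, hc2, hc3, hc4, hc5, hc6⟩ : _ ∧ _ ∧ _ ∧ _ ∧ _ ∧ _) <|
    And.intro (⟨Ne.symm hr1, Ne.symm hr2, Ne.symm hr3, Ne.symm hr4, Ne.symm hr5, Ne.symm hr6,
      Ne.symm hr7⟩ : _ ∧ _ ∧ _ ∧ _ ∧ _ ∧ _ ∧ _)
    (⟨Ne.symm hc1, Ne.symm hc2, Ne.symm hc3, Ne.symm hc4, Ne.symm hc5, Ne.symm hc6⟩ :
      _ ∧ _ ∧ _ ∧ _ ∧ _ ∧ _)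
  -- The start value is generalized because each round changes it before the remaining `j` rounds.
  have key : ∀ (j v₀ : ℕ), v₀ < σ.reg p → ∃ v,
      Runs W (.loop c (block (.arith .mul r r b)
        [.arith .add r r a, .arith .mod r r p, .arith .sub c c one]))
        ((σ.set r v₀).set c j) ((σ.set r v).set c 0) ∧ v < σ.reg p ∧
      (v : ZMod (σ.reg p)) = v₀ * (σ.reg b : ZMod (σ.reg p)) ^ j +
        σ.reg a * ∑ i ∈ Finset.range j, (σ.reg b : ZMod (σ.reg p)) ^ i := by
    intro j
    induction j with
    | zero => exact fun v₀ h => ⟨v₀, Runs.loop_stop (by simp), h, by simp⟩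
    | succ j ih =>
      intro v₀ h
      obtain ⟨v, h1, h2, h3⟩ := ih ((v₀ * σ.reg b + σ.reg a) % σ.reg p) (Nat.mod_lt _ hp)
      refine ⟨v, .loop_step (by simp) (τ := (σ.set r _).set c j) ?_ h1, h2, ?_⟩
      · have hm : v₀ * σ.reg b ≤ σ.reg p * σ.reg b := Nat.mul_le_mul_right _ h.le
        have hm' := Nat.mod_lt (v₀ * σ.reg b + σ.reg a) hp
        -- The counter is bounded by the fit of the starting state itself, which holds `j + 1`.
        have hj : ((σ.set r v₀).set c (j + 1)).Fits W → j ≤ W := fun h => by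
          have := h c
          simp at this; omega
        intro hfit
        have hj := hj hfit
        have := Runs.block (W := W) (σ := (σ.set r v₀).set c (j + 1)) (i := .arith .mul r r b)
          (is := [.arith .add r r a, .arith .mod r r p, .arith .sub c c one]) (by
            simp [AllSmall, Instr.Small, Instr.apply, Op.eval, hone, ne]
            omega)
        rw [← show _ = ((σ.set r ((v₀ * σ.reg b + σ.reg a) % σ.reg p)).set c j) from ?_]
        · exact this hfit
        apply State.ext'
        · intro i
          by_cases hi : i = c <;> by_cases hi' : i = r <;>
            simp [applyAll, Instr.apply, Op.eval, hone, ne, hi, hi']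
        · simp [applyAll, Instr.apply]
        · simp [applyAll, Instr.apply]
      · rw [h3, Finset.sum_range_succ]
        push_cast [ZMod.natCast_mod]
        ring
  obtain ⟨v, h1, h2⟩ := key (σ.reg e) r₀ hr₀
  refine ⟨v, Runs.seq ?_ h1, h2⟩
  have := Runs.block (W := W) (σ := σ) (i := .const r r₀) (is := [.arith .add c zero e]) (by
    simp [AllSmall, Instr.Small, Instr.apply, Op.eval, hzero, ne, he]; omega)
  convert this using 1
  simp [applyAll, Instr.apply, Op.eval, hzero, ne]
open MeasureTheory

/-! ### Random numbers -/

/-- The number with the binary digits `ω 0, …, ω (b - 1)`, most significant first. -/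
def coinNumber (ω : ℕ → Bool) : ℕ → ℕ
  | 0 => 0
  | b + 1 => 2 * coinNumber ω b + (ω b).toNat

theorem coinNumber_lt (ω : ℕ → Bool) (b : ℕ) : coinNumber ω b < 2 ^ b := by
  induction b with
  | zero => simp [coinNumber]
  | succ b ih =>
    have := Bool.toNat_le (ω b)
    simp only [coinNumber, pow_succ]; omega

theorem eq_of_coinNumber_eq {ω η : ℕ → Bool} {b : ℕ} (h : coinNumber ω b = coinNumber η b) :
    ∀ i < b, ω i = η i := by
  induction b with
  | zero => simp
  | succ b ih =>
    simp only [coinNumber] at h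
    have h1 := Bool.toNat_le (ω b)
    have h2 := Bool.toNat_le (η b)
    intro i hi
    rcases Nat.lt_succ_iff_lt_or_eq.1 hi with hi | rfl
    · exact ih (by omega) i hi
    · have h3 : (ω i).toNat = (η i).toNat := by omega
      revert h3; cases ω i <;> cases η i <;> simp

instance : IsProbabilityMeasure coinMeasure := by
  unfold coinMeasure; infer_instance

/-- A nonempty fibre lies in the cylinder fixing the first `b` bits of one of its members. Only this
upper bound is needed. -/
theorem coinMeasure_coinNumber_eq_le (b a : ℕ) :
    coinMeasure.real {ω | coinNumber ω b = a} ≤ (1 / 2) ^ b := by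
  rcases Set.eq_empty_or_nonempty {ω | coinNumber ω b = a} with h | ⟨η, hη⟩
  · rw [h]; simp
  · have hsub : {ω | coinNumber ω b = a} ⊆ Set.pi (Finset.range b) fun i => {η i} := by
      intro ω hω i hi
      exact eq_of_coinNumber_eq (hω.trans (Eq.symm hη)) i (by simpa using hi)
    refine (measureReal_mono hsub).trans_eq ?_
    rw [Measure.real, coinMeasure, Measure.infinitePi_pi _ (fun _ _ => measurableSet_singleton _)]
    simp

/-- Union bound over the bad values in `R`. Working by subadditivity from a cover of the whole space
avoids any measurability of `S`. -/
theorem le_coinMeasure_of_card_le {b : ℕ} {R : Finset ℕ} {S : Set (ℕ → Bool)}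
    (hR : 100 * R.card ≤ 2 ^ b) (hS : ∀ ω, coinNumber ω b ∉ R → ω ∈ S) :
    99 / 100 ≤ coinMeasure.real S := by
  have hcov : (Set.univ : Set (ℕ → Bool)) ⊆ S ∪ ⋃ a ∈ R, {ω | coinNumber ω b = a} := by
    intro ω _
    by_cases h : coinNumber ω b ∈ R
    · right; simpa using h
    · left; exact hS ω h
  have h1 : coinMeasure.real (⋃ a ∈ R, {ω | coinNumber ω b = a}) ≤ R.card * (1 / 2) ^ b := by
    refine (measureReal_biUnion_finset_le _ _).trans ?_
    refine (Finset.sum_le_sum fun a _ => coinMeasure_coinNumber_eq_le b a).trans_eq ?_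
    simp
  have h2 : (1 : ℝ) ≤ coinMeasure.real S + R.card * (1 / 2) ^ b := by
    calc (1 : ℝ) = coinMeasure.real Set.univ := by simp
      _ ≤ _ := measureReal_mono hcov
      _ ≤ _ := measureReal_union_le _ _
      _ ≤ _ := by gcongr
  have h3 : (100 : ℝ) * R.card ≤ 2 ^ b := by exact_mod_cast hR
  have h4 : (R.card : ℝ) * (1 / 2) ^ b ≤ 1 / 100 := by
    rw [one_div, inv_pow, ← div_eq_mul_inv, div_le_div_iff₀ (by positivity) (by norm_num)]
    linarith
  linarith

/-! ### The sign matrix -/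

section Matrix

variable {n : ℕ} (G : CompleteSignedGraph (Fin n)) (R : Type*) [CommRing R]

open Classical in
/-- The entries of the sign matrix, with ones on the diagonal. -/
noncomputable def CompleteSignedGraph.entry (u v : Fin n) : R := if G.neg.Adj u v then -1 else 1

/-- The sum of the values of `φ`, weighted with the entries of the sign matrix. -/
noncomputable def CompleteSignedGraph.form {R : Type*} [CommRing R] (φ : ℕ → ℕ → R) : R :=
  ∑ u, ∑ v, G.entry R u v * φ u v

/-- The sign of an item, as a number. -/
def Item.weight (t : Item n) : R := match t.sign with | .plus => 1 | .minus => -1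

variable {R}

/-- The contribution of an item to `CompleteSignedGraph.form`. -/
def Item.term (φ : ℕ → ℕ → R) (t : Item n) : R := t.weight R * (φ t.u t.v + φ t.v t.u)

theorem CompleteSignedGraph.entry_self (u : Fin n) : G.entry R u u = 1 := by simp [entry]

theorem CompleteSignedGraph.entry_comm (u v : Fin n) : G.entry R u v = G.entry R v u := by
  classical
  unfold entry; rw [if_congr (G.neg.adj_comm u v) rfl rfl]

variable {G}

theorem CompleteSignedGraph.IsStream.weight_eq {l : List (Item n)} (h : G.IsStream l) {t : Item n}
    (ht : t ∈ l) : t.weight R = G.entry R t.u t.v ∧ t.u ≠ t.v := by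
  have := h.sign_correct t ht
  unfold Item.weight entry
  cases hs : t.sign with
  | plus =>
    rw [hs] at this
    have := (G.pos_adj_iff _ _).1 this
    simp [this.1, this.2]
  | minus =>
    rw [hs] at this
    exact ⟨by simp [this], G.neg.ne_of_adj this⟩

/-- Each item supplies the two ordered pairs of its edge, and every off-diagonal pair is supplied
exactly once. The diagonal is never streamed and has entries one. -/
theorem CompleteSignedGraph.IsStream.form_eq {l : List (Item n)} (h : G.IsStream l)
    (φ : ℕ → ℕ → R) :
    G.form φ = ∑ i ∈ Finset.range n, φ i i + (l.map (Item.term φ)).sum := by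
  classical
  have h1 : ∀ t ∈ l, Item.term φ t =
      ∑ u, ∑ v, if t.edge = s(u, v) then G.entry R u v * φ u v else 0 := by
    intro t ht
    obtain ⟨hw, hne⟩ := h.weight_eq (R := R) ht
    have : ∀ u v : Fin n, (if t.edge = s(u, v) then G.entry R u v * φ u v else 0) =
        (if t.u = u then (if t.v = v then G.entry R u v * φ u v else 0) else 0) +
        (if t.v = u then (if t.u = v then G.entry R u v * φ u v else 0) else 0) := by
      intro u v
      unfold Item.edge
      by_cases h1 : t.u = u <;> by_cases h2 : t.v = v <;> by_cases h3 : t.v = u <;>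
        by_cases h4 : t.u = v <;> simp_all
    simp only [this, Finset.sum_add_distrib, Finset.sum_ite_irrel, Finset.sum_const_zero,
      Finset.sum_ite_eq, Finset.mem_univ, if_true]
    rw [Item.term, hw, G.entry_comm t.v t.u]
    ring
  have h2 : (l.map (Item.term φ)).sum =
      ∑ u, ∑ v, ((l.map Item.edge).count s(u, v) : R) * (G.entry R u v * φ u v) := by
    rw [List.map_congr_left h1]
    clear h1 h
    induction l with
    | nil => simp
    | cons t l ih =>
      simp only [List.map_cons, List.sum_cons, ih, ← Finset.sum_add_distrib, List.count_cons]
      refine Finset.sum_congr rfl fun u _ => Finset.sum_congr rfl fun v _ => ?_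
      by_cases ht : t.edge = s(u, v) <;> simp [ht]
      ring
  -- `exactly_once` says nothing about loops; they are absent because an item's end points are
  -- adjacent in one of two simple graphs.
  have h3 : ∀ u v : Fin n, ((l.map Item.edge).count s(u, v) : R) = if u = v then 0 else 1 := by
    intro u v
    by_cases huv : u = v
    · subst huv
      have : (l.map Item.edge).count s(u, u) = 0 := by
        rw [List.count_eq_zero]
        intro hm
        obtain ⟨t, ht, hte⟩ := List.mem_map.1 hm
        have := (h.weight_eq (R := R) ht).2
        simp only [Item.edge, Sym2.eq_iff] at hte
        rcases hte with ⟨a, b⟩ | ⟨a, b⟩ <;> exact this (a.trans b.symm)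
      simp [this]
    · simp [h.exactly_once u v huv, huv]
  rw [h2, ← Fin.sum_univ_eq_sum_range (fun i => φ i i), ← Finset.sum_add_distrib]
  refine Finset.sum_congr rfl fun u _ => ?_
  rw [← Finset.add_sum_erase _ _ (Finset.mem_univ u), ← Finset.add_sum_erase _ (fun v =>
    ((l.map Item.edge).count s(u, v) : R) * _) (Finset.mem_univ u)]
  rw [h3, if_pos rfl, G.entry_self]
  simp only [zero_mul, zero_add, one_mul]
  congr 1
  refine Finset.sum_congr rfl fun v hv => ?_
  rw [h3, if_neg (Finset.ne_of_mem_erase hv).symm, one_mul]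

/-- The sign matrix of a balanced graph has rank one. -/
theorem CompleteSignedGraph.IsBalanced.entry_eq (h : G.IsBalanced) (a u v : Fin n) :
    G.entry R u v = G.entry R a u * G.entry R a v := by
  obtain ⟨L, hp, hn⟩ := G.isBalanced_iff_exists_partition.1 h
  have key : ∀ x y, G.neg.Adj x y ↔ ¬ (x ∈ L ↔ y ∈ L) := by
    intro x y
    by_cases hxy : x = y
    · subst hxy; simp
    refine ⟨fun hx => by have := hn x y hx; tauto, fun hL => ?_⟩
    by_contra hc
    exact hL (hp x y ((G.pos_adj_iff x y).2 ⟨hxy, hc⟩))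
  classical
  unfold entry
  rw [if_congr (key u v) rfl rfl, if_congr (key a u) rfl rfl, if_congr (key a v) rfl rfl]
  by_cases h1 : u ∈ L <;> by_cases h2 : v ∈ L <;> by_cases h3 : a ∈ L <;> simp [h1, h2, h3]

/-- When `1 ≠ -1` an entry determines its sign, and the minus neighbours of `a` form one side of the
bipartition. -/
theorem CompleteSignedGraph.isBalanced_of_entry_eq (hR : (1 : R) ≠ -1) (a : Fin n)
    (h : ∀ u v, G.entry R u v = G.entry R a u * G.entry R a v) : G.IsBalanced := by
  rw [isBalanced_iff_exists_partition]
  have key : ∀ u v, G.neg.Adj u v ↔ ¬ (G.neg.Adj a u ↔ G.neg.Adj a v) := by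
    intro u v
    have := h u v
    unfold entry at this
    by_cases h1 : G.neg.Adj a u <;> by_cases h2 : G.neg.Adj u v <;>
      by_cases h3 : G.neg.Adj a v <;> simp_all [eq_comm]
  refine ⟨{u | G.neg.Adj a u}, fun u v huv => ?_, fun u v huv => ?_⟩
  · have h1 := (G.pos_adj_iff u v).1 huv
    have := key u v
    simp only [Set.mem_ofPred_eq]; tauto
  · have := key u v
    simp only [Set.mem_ofPred_eq]; tauto

/-! ### The polynomial identity test -/

variable (G)

/-- The test quantity of the algorithm vanishes. -/
def CompleteSignedGraph.Passes (x : R) : Prop :=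
  G.form (fun u v => x ^ u * (x ^ n) ^ v) =
    G.form (fun u v => ((1 - u : ℕ) : R) * x ^ v) *
      G.form (fun u v => ((1 - u : ℕ) : R) * (x ^ n) ^ v)

variable {G}

/-- The truncated difference `1 - u` is the indicator of `u = 0`; it writes a row sum as a form, so
that `form_eq` applies to it. -/
theorem CompleteSignedGraph.form_first_row [NeZero n] (ψ : ℕ → R) :
    G.form (fun u v => ((1 - u : ℕ) : R) * ψ v) = ∑ v, G.entry R 0 v * ψ v := by
  unfold form
  rw [Finset.sum_eq_single 0]
  · simp
  · intro u _ hu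
    have : 1 - (u : ℕ) = 0 := by
      have : (u : ℕ) ≠ 0 := fun h => hu (Fin.ext (by simpa using h))
      omega
    simp [this]
  · simp

/-- The product of the two row sums is the form of the rank-one matrix, and `x ^ u * (x ^ n) ^ v = x
^ (u + n * v)` merges both variables into one. -/
theorem CompleteSignedGraph.passes_iff [NeZero n] (x : R) :
    G.Passes x ↔ ∑ u, ∑ v, (G.entry R u v - G.entry R 0 u * G.entry R 0 v) *
      x ^ ((u : ℕ) + n * v) = 0 := by
  unfold Passes
  rw [form_first_row, form_first_row, Finset.sum_mul_sum, ← sub_eq_zero, form,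
    ← Finset.sum_sub_distrib]
  simp only [← Finset.sum_sub_distrib]
  refine Eq.congr (Finset.sum_congr rfl fun u _ => Finset.sum_congr rfl fun v _ => ?_) rfl
  rw [pow_add, pow_mul]
  ring

theorem CompleteSignedGraph.IsBalanced.passes (h : G.IsBalanced) (x : R) : G.Passes x := by
  rcases n with _ | n
  · simp [Passes, form]
  · rw [passes_iff]
    exact Finset.sum_eq_zero fun u _ => Finset.sum_eq_zero fun v _ => by
      rw [h.entry_eq 0 u v, sub_self, zero_mul]

/-- For an unbalanced graph, the test passes at fewer than `n ^ 2` points. -/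
theorem CompleteSignedGraph.exists_roots [IsDomain R] (hR : (1 : R) ≠ -1) (h : ¬ G.IsBalanced) :
    ∃ S : Finset R, S.card ≤ n ^ 2 ∧ ∀ x : R, G.Passes x → x ∈ S := by
  classical
  rcases n with _ | n
  · exact absurd (fun u => u.elim0) h
  obtain ⟨a, b, hab⟩ : ∃ u v, G.entry R u v - G.entry R 0 u * G.entry R 0 v ≠ 0 := by
    by_contra! hc
    exact h (isBalanced_of_entry_eq hR 0 fun u v => sub_eq_zero.1 (hc u v))
  let P : Polynomial R := ∑ u : Fin (n + 1), ∑ v : Fin (n + 1), Polynomial.monomial ((u : ℕ) + (n + 1) * v)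
    (G.entry R u v - G.entry R 0 u * G.entry R 0 v)
  have hcoeff : P.coeff ((a : ℕ) + (n + 1) * b) =
      G.entry R a b - G.entry R 0 a * G.entry R 0 b := by
    simp only [P, Polynomial.finsetSum_coeff, Polynomial.coeff_monomial]
    -- Uniqueness of base `n + 1` digits: no two matrix entries share a monomial, so nothing
    -- cancels.
    have : ∀ u v : Fin (n + 1), ((u : ℕ) + (n + 1) * v = a + (n + 1) * b) ↔ u = a ∧ v = b := by
      intro u v
      refine ⟨fun h => ?_, fun h => by rw [h.1, h.2]⟩
      have h1 := congrArg (· % (n + 1)) h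
      simp only [Nat.add_mul_mod_self_left, Nat.mod_eq_of_lt u.2, Nat.mod_eq_of_lt a.2] at h1
      rw [h1] at h
      have h2 : (v : ℕ) = b := Nat.eq_of_mul_eq_mul_left n.succ_pos (Nat.add_left_cancel h)
      exact ⟨Fin.ext h1, Fin.ext h2⟩
    simp only [this]
    rw [Finset.sum_eq_single a, Finset.sum_eq_single b] <;> simp +contextual
  have hP : P ≠ 0 := fun h0 => hab (by rw [← hcoeff, h0, Polynomial.coeff_zero])
  have hdeg : P.natDegree ≤ (n + 1) ^ 2 := by
    refine Polynomial.natDegree_sum_le_of_forall_le _ _ fun u _ =>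
      Polynomial.natDegree_sum_le_of_forall_le _ _ fun v _ =>
        (Polynomial.natDegree_monomial_le _).trans ?_
    have hu := u.2
    have hv : (n + 1) * (v : ℕ) ≤ (n + 1) * n := Nat.mul_le_mul_left _ (by omega)
    nlinarith
  refine ⟨P.roots.toFinset, (Multiset.toFinset_card_le _).trans ((P.card_roots').trans hdeg),
    fun x hx => ?_⟩
  rw [Multiset.mem_toFinset, Polynomial.mem_roots hP, Polynomial.IsRoot.def]
  simpa only [P, Polynomial.eval_finsetSum, Polynomial.eval_monomial] using (passes_iff x).1 hx

end Matrix

/-- Random numbers avoid the points where the test is passed by an unbalanced graph. -/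
theorem CompleteSignedGraph.le_coinMeasure_not_passes {n p b : ℕ} [Fact p.Prime]
    {G : CompleteSignedGraph (Fin n)} (h : ¬ G.IsBalanced) (hp : 2 < p) (hb : 2 ^ b ≤ p)
    (hn : 100 * n ^ 2 ≤ 2 ^ b) {S : Set (ℕ → Bool)}
    (hS : ∀ ω, ¬ G.Passes (coinNumber ω b : ZMod p) → ω ∈ S) :
    99 / 100 ≤ coinMeasure.real S := by
  classical
  have : Fact (2 < p) := ⟨hp⟩
  obtain ⟨T, hT, hT'⟩ := G.exists_roots (R := ZMod p) (ZMod.neg_one_ne_one).symm h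
  -- Coin numbers are below `2 ^ b ≤ p`, so they are their own residues; a bad point is hit only by
  -- the representative of a root.
  refine le_coinMeasure_of_card_le (b := b) (R := T.image ZMod.val) ?_ fun ω hω => hS ω fun hx => ?_
  · have := Finset.card_image_le (s := T) (f := ZMod.val)
    omega
  · refine hω (Finset.mem_image.2 ⟨_, hT' _ hx, ?_⟩)
    exact ZMod.val_natCast_of_lt ((coinNumber_lt ω b).trans_le hb)

/-! ### The algorithm -/

namespace Reg

/-- number of vertices -/
@[simp] def n : Fin 27 := 0
/-- least size of the sample space -/
@[simp] def size : Fin 27 := 1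
/-- current size of the sample space -/
@[simp] def pow : Fin 27 := 2
/-- random point -/
@[simp] def x : Fin 27 := 3
/-- the constant one -/
@[simp] def one : Fin 27 := 4
/-- the constant zero -/
@[simp] def zero : Fin 27 := 5
/-- modulus -/
@[simp] def p : Fin 27 := 6
/-- random bit, trial divisor, or product of `x` and `y` -/
@[simp] def d : Fin 27 := 7
/-- scratch -/
@[simp] def t : Fin 27 := 8
/-- the point `x ^ n` -/
@[simp] def y : Fin 27 := 9
/-- form at `(x, y)` -/
@[simp] def fxy : Fin 27 := 10
/-- first row at `x` -/
@[simp] def fx : Fin 27 := 11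
/-- first row at `y` -/
@[simp] def fy : Fin 27 := 12
/-- end point of the current edge -/
@[simp] def u : Fin 27 := 13
/-- end point of the current edge -/
@[simp] def v : Fin 27 := 14
/-- sign of the current edge -/
@[simp] def s : Fin 27 := 15
/-- whether an edge has been read -/
@[simp] def e : Fin 27 := 16
/-- residue of the sign -/
@[simp] def m : Fin 27 := 17
/-- `x ^ u` -/
@[simp] def xu : Fin 27 := 18
/-- `x ^ v` -/
@[simp] def xv : Fin 27 := 19
/-- `y ^ u` -/
@[simp] def yu : Fin 27 := 20
/-- `y ^ v` -/
@[simp] def yv : Fin 27 := 21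
/-- whether `u = 0` -/
@[simp] def du : Fin 27 := 22
/-- whether `v = 0` -/
@[simp] def dv : Fin 27 := 23
/-- loop counter -/
@[simp] def c : Fin 27 := 24
/-- scratch -/
@[simp] def t' : Fin 27 := 25
/-- answer -/
@[simp] def out : Fin 27 := 26

end Reg

/-- Draw a random number `x` below the least power of two that is at least `100 * n ^ 2`. -/
def sampleProg : Prog 27 :=
  .seq (block (.const Reg.one 1) [.const Reg.size 100, .arith .mul Reg.size Reg.size Reg.n,
      .arith .mul Reg.size Reg.size Reg.n, .const Reg.pow 1, .arith .sub Reg.t Reg.size Reg.pow])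
    -- `t` is the truncated `size - pow`, so the loop stops once `pow` has reached `size`.
    (.loop Reg.t (block (.flip Reg.d) [.arith .add Reg.x Reg.x Reg.x, .arith .add Reg.x Reg.x Reg.d,
      .arith .add Reg.pow Reg.pow Reg.pow, .arith .sub Reg.t Reg.size Reg.pow]))

/-- Find the least prime number that exceeds the size of the sample space by at least three. -/
def primeProg : Prog 27 :=
  .seq (block (.const Reg.d 2) [.arith .add Reg.p Reg.pow Reg.d, .arith .add Reg.p Reg.p Reg.one,
      .arith .sub Reg.t Reg.p Reg.d])
    (.loop Reg.t (.seq (block (.arith .mod Reg.t Reg.p Reg.d) []) (.seq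
      -- Trial division: a nonzero remainder advances the divisor; a proper divisor rejects `p` and
      -- restarts at 2. The loop ends when the divisor reaches `p`.
      (.cond Reg.t (block (.arith .add Reg.d Reg.d Reg.one) [])
        (block (.arith .add Reg.p Reg.p Reg.one) [.const Reg.d 2]))
      (block (.arith .sub Reg.t Reg.p Reg.d) []))))

/-- Power of a register modulo `p`. -/
def powProg (b e r : Fin 27) : Prog 27 := horner Reg.one Reg.p Reg.zero 1 b Reg.zero e r Reg.c

/-- Compute `y` and the contributions of the diagonal of the sign matrix. -/
def diagProg : Prog 27 :=
  .seq (powProg Reg.x Reg.n Reg.y) <| .seq (block (.arith .mul Reg.d Reg.x Reg.y) []) <|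
  .seq (horner Reg.one Reg.p Reg.zero 0 Reg.d Reg.one Reg.n Reg.fxy Reg.c) <|
  -- Truncated, `1 - (1 - n)` is 1 for positive `n` and 0 for `n = 0`: the diagonal entry of the
  -- first row, if there is one.
  block (.arith .sub Reg.fx Reg.one Reg.n) [.arith .sub Reg.fx Reg.one Reg.fx,
    .arith .add Reg.fy Reg.fx Reg.zero]

/-- `r := (r + (a * b + a' * b') * m) mod p`. -/
def accProg (r a b a' b' : Fin 27) : Prog 27 :=
  block (.arith .mul Reg.t a b) [.arith .mul Reg.t' a' b', .arith .add Reg.t Reg.t Reg.t',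
    .arith .mul Reg.t Reg.t Reg.m, .arith .add Reg.t Reg.t r, .arith .mod r Reg.t Reg.p]

/-- Compute the coefficients of the current edge. -/
def prepProg : Prog 27 :=
  .seq (powProg Reg.x Reg.u Reg.xu) <| .seq (powProg Reg.x Reg.v Reg.xv) <|
  .seq (powProg Reg.y Reg.u Reg.yu) <| .seq (powProg Reg.y Reg.v Reg.yv) <|
  block (.arith .sub Reg.du Reg.one Reg.u) [.arith .sub Reg.dv Reg.one Reg.v,
    -- `m` becomes `(p - 2) * s + 1`, which is `1` for plus and `p - 1`, that is `-1` modulo `p`,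
    -- for minus.
    .arith .sub Reg.m Reg.p Reg.one, .arith .sub Reg.m Reg.m Reg.one,
    .arith .mul Reg.m Reg.m Reg.s, .arith .add Reg.m Reg.m Reg.one]

/-- Add the contributions of the current edge. -/
def edgeProg : Prog 27 :=
  .seq prepProg <| .seq (accProg Reg.fxy Reg.xu Reg.yv Reg.xv Reg.yu) <|
  .seq (accProg Reg.fx Reg.du Reg.xv Reg.dv Reg.xu) (accProg Reg.fy Reg.du Reg.yv Reg.dv Reg.yu)

/-- Read the next edge. -/
def readInstr : Instr 27 := .read Reg.u Reg.v Reg.s Reg.e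

/-- Process the stream. -/
def streamProg : Prog 27 :=
  .seq (.instr readInstr) (.loop Reg.e (.seq edgeProg (.instr readInstr)))

/-- Compare the form with the product of the first rows. -/
def answerProg : Prog 27 :=
  block (.arith .mul Reg.t Reg.fx Reg.fy) [.arith .mod Reg.t Reg.t Reg.p,
    -- The two truncated differences add up to the absolute difference, which is zero exactly on
    -- equality.
    .arith .sub Reg.t' Reg.fxy Reg.t, .arith .sub Reg.t Reg.t Reg.fxy,
    .arith .add Reg.t Reg.t Reg.t', .arith .sub Reg.out Reg.one Reg.t]

/-- The streaming algorithm. -/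
def balanceAlg : StreamAlg where
  k := 27
  nReg := Reg.n
  outReg := Reg.out
  prog := .seq sampleProg <| .seq primeProg <| .seq diagProg <| .seq streamProg answerProg

/-! ### Correctness of the parts -/

/-- The number of random bits. -/
def bitCount (n : ℕ) : ℕ := Nat.clog 2 (100 * n ^ 2)

theorem two_pow_bitCount_le (n : ℕ) : 2 ^ bitCount n ≤ 200 * n ^ 2 + 1 := by
  rcases h : bitCount n with _ | b
  · simp
  · have : ¬ 100 * n ^ 2 ≤ 2 ^ b := fun hb => by
      have := Nat.clog_le_of_le_pow hb
      unfold bitCount at h; omega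
    rw [pow_succ]; omega

theorem le_two_pow_bitCount (n : ℕ) : 100 * n ^ 2 ≤ 2 ^ bitCount n :=
  Nat.le_pow_clog (by norm_num) _

theorem runs_sample {W n : ℕ} {σ : State 27} (hn : σ.reg Reg.n = n) (hx : σ.reg Reg.x = 0)
    (hz : σ.reg Reg.zero = 0) (hW : 400 * n ^ 2 + 100 * n + 100 ≤ W) :
    ∃ τ, Runs W sampleProg σ τ ∧ τ.reg Reg.n = n ∧ τ.reg Reg.zero = 0 ∧ τ.reg Reg.one = 1 ∧
      τ.input = σ.input ∧ τ.reg Reg.x = coinNumber σ.coins (bitCount n) ∧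
      τ.reg Reg.pow = 2 ^ bitCount n := by
  -- `b` counts the flips so far. The last clause, that no earlier power sufficed, identifies the
  -- final `b` with `bitCount n`.
  let I : State 27 → Prop := fun τ => ∃ b, τ.reg Reg.n = n ∧ τ.reg Reg.zero = 0 ∧
    τ.reg Reg.one = 1 ∧ τ.input = σ.input ∧ τ.coins = (fun i => σ.coins (i + b)) ∧
    τ.reg Reg.x = coinNumber σ.coins b ∧ τ.reg Reg.pow = 2 ^ b ∧ τ.reg Reg.size = 100 * n ^ 2 ∧
    τ.reg Reg.t = 100 * n ^ 2 - 2 ^ b ∧ ∀ i < b, 2 ^ i < 100 * n ^ 2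
  obtain ⟨σ₁, hinit, hI⟩ : ∃ σ₁, Runs W (block (.const Reg.one 1) [.const Reg.size 100,
      .arith .mul Reg.size Reg.size Reg.n, .arith .mul Reg.size Reg.size Reg.n, .const Reg.pow 1,
      .arith .sub Reg.t Reg.size Reg.pow]) σ σ₁ ∧ I σ₁ := by
    simp at hn hx hz
    refine ⟨_, Runs.block ?_, 0, ?_⟩
    · simp [AllSmall, Instr.Small, Instr.apply, Op.eval, hn]
      rw [mul_assoc, ← sq]
      omega
    · simp [applyAll, Instr.apply, Op.eval, hn, hx, hz, coinNumber]
      rw [mul_assoc, ← sq]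
      simp
  obtain ⟨τ, h1, ⟨b, h2, h3, h4, h5, -, h6, h7, -, h8, h9⟩, h10⟩ :=
    Runs.loop_of_measure (W := W) (x := Reg.t) (p := block (.flip Reg.d)
      [.arith .add Reg.x Reg.x Reg.x, .arith .add Reg.x Reg.x Reg.d,
      .arith .add Reg.pow Reg.pow Reg.pow, .arith .sub Reg.t Reg.size Reg.pow]) I
      (fun τ => τ.reg Reg.t) (by
        rintro τ ⟨b, h2, h3, h4, h5, h6, h7, h8, h9, h10, h11⟩ ht
        have hx := coinNumber_lt σ.coins b
        have hb := Bool.toNat_le (σ.coins b)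
        have hpos : 0 < 2 ^ b := by positivity
        refine ⟨_, Runs.block ?_, ⟨b + 1, ?_, ?_, ?_, ?_, ?_, ?_, ?_, ?_, ?_, ?_⟩, ?_⟩
        all_goals simp at h2 h3 h4 h7 h8 h9 h10 ht
        · simp [AllSmall, Instr.Small, Instr.apply, Op.eval, h6, h7, h8, h9]
          omega
        all_goals simp [applyAll, Instr.apply, Op.eval, *]
        · funext i; congr 1; omega
        · simp [coinNumber]; omega
        · rw [pow_succ]; omega
        · rw [pow_succ]; omega
        · intro i hi
          rcases Nat.lt_or_eq_of_le hi with hi | rfl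
          · exact h11 i hi
          · omega
        · omega) σ₁ hI
  have hb : b = bitCount n := by
    have h11 : 100 * n ^ 2 ≤ 2 ^ b := by omega
    refine le_antisymm (not_lt.1 fun hlt => ?_) (Nat.clog_le_of_le_pow h11)
    have := h9 _ hlt
    have := le_two_pow_bitCount n
    omega
  subst hb
  exact ⟨τ, hinit.seq h1, h2, h3, h4, h5, h6, h7⟩

/-- The least prime number that is at least `q + 3`. -/
noncomputable def primeAbove (q : ℕ) : ℕ := Nat.find (Nat.exists_infinite_primes (q + 3))

theorem prime_primeAbove (q : ℕ) : (primeAbove q).Prime :=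
  (Nat.find_spec (Nat.exists_infinite_primes (q + 3))).2

theorem le_primeAbove (q : ℕ) : q + 3 ≤ primeAbove q :=
  (Nat.find_spec (Nat.exists_infinite_primes (q + 3))).1

/-- Bertrand's postulate at `q + 2`; this keeps the modulus linear in the size of the sample space.
-/
theorem primeAbove_le (q : ℕ) : primeAbove q ≤ 2 * (q + 2) := by
  obtain ⟨p, hp, h1, h2⟩ := Nat.exists_prime_lt_and_le_two_mul (q + 2) (by omega)
  exact (Nat.find_min' (Nat.exists_infinite_primes (q + 3)) ⟨h1, hp⟩).trans h2

theorem runs_prime {W q : ℕ} {σ : State 27} (hq : σ.reg Reg.pow = q) (hone : σ.reg Reg.one = 1)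
    (hW : primeAbove q ≤ W) :
    ∃ τ, Runs W primeProg σ τ ∧ τ.reg Reg.n = σ.reg Reg.n ∧ τ.reg Reg.zero = σ.reg Reg.zero ∧
      τ.reg Reg.one = 1 ∧ τ.input = σ.input ∧ τ.reg Reg.x = σ.reg Reg.x ∧
      τ.reg Reg.p = primeAbove q := by
  have hge := le_primeAbove q
  let I : State 27 → Prop := fun τ => τ.reg Reg.n = σ.reg Reg.n ∧ τ.reg Reg.zero = σ.reg Reg.zero ∧
    τ.reg Reg.one = 1 ∧ τ.input = σ.input ∧ τ.reg Reg.x = σ.reg Reg.x ∧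
    q + 3 ≤ τ.reg Reg.p ∧ τ.reg Reg.p ≤ primeAbove q ∧ 2 ≤ τ.reg Reg.d ∧
    τ.reg Reg.d ≤ τ.reg Reg.p ∧ (∀ j, 2 ≤ j → j < τ.reg Reg.d → ¬ j ∣ τ.reg Reg.p) ∧
    τ.reg Reg.t = τ.reg Reg.p - τ.reg Reg.d
  obtain ⟨σ₁, hinit, hI⟩ : ∃ σ₁, Runs W (block (.const Reg.d 2) [.arith .add Reg.p Reg.pow Reg.d,
      .arith .add Reg.p Reg.p Reg.one, .arith .sub Reg.t Reg.p Reg.d]) σ σ₁ ∧ I σ₁ := by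
    simp at hq hone
    refine ⟨_, Runs.block ?_, ?_⟩
    · simp [AllSmall, Instr.Small, Instr.apply, Op.eval, hq, hone]
      omega
    · simp [I, applyAll, Instr.apply, Op.eval, hq, hone]
      and_intros <;> intros <;> omega
  obtain ⟨τ, h1, ⟨h2, h3, h4, h5, h6, h7, h8, h9, h10, h11, h12⟩, h13⟩ :=
    Runs.loop_of_measure (W := W) (x := Reg.t) (p := .seq (block (.arith .mod Reg.t Reg.p Reg.d) [])
      (.seq (.cond Reg.t (block (.arith .add Reg.d Reg.d Reg.one) [])
        (block (.arith .add Reg.p Reg.p Reg.one) [.const Reg.d 2]))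
      (block (.arith .sub Reg.t Reg.p Reg.d) []))) I
      -- Lexicographic descent coded in one number: the candidate `p` counts first, then the
      -- divisor, which may fall back to 2 when `p` grows.
      (fun τ => (primeAbove q - τ.reg Reg.p) * (primeAbove q + 1) + (primeAbove q - τ.reg Reg.d)) (by
        rintro τ ⟨h2, h3, h4, h5, h6, h7, h8, h9, h10, h11, h12⟩ ht
        rw [h12] at ht
        have hmod := Nat.mod_lt (τ.reg Reg.p) (show 0 < τ.reg Reg.d by omega)
        by_cases hdvd : τ.reg Reg.p % τ.reg Reg.d = 0
        -- A divisor `d` with `2 ≤ d < p` shows that the candidate is composite, so it lies below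
        -- the target and can be increased safely.
        · have hlt : τ.reg Reg.p < primeAbove q := by
            refine lt_of_le_of_ne h8 fun heq => ?_
            have hp := prime_primeAbove q
            rw [← heq] at hp
            rcases (Nat.dvd_prime hp).1 (Nat.dvd_of_mod_eq_zero hdvd) with h | h <;> omega
          refine ⟨_, (Runs.block ?_).seq ((Runs.cond_false ?_ (Runs.block ?_)).seq (Runs.block ?_)),
            ⟨?_, ?_, ?_, ?_, ?_, ?_, ?_, ?_, ?_, ?_, ?_⟩, ?_⟩
          all_goals
            simp at h2 h3 h4 h6 h7 h8 h9 h10 hdvd hmod hlt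
            simp [AllSmall, applyAll, Instr.Small, Instr.apply, Op.eval, *]
          any_goals omega
          obtain ⟨r, hr⟩ : ∃ r, primeAbove q - τ.reg 6 = r + 1 :=
            ⟨primeAbove q - τ.reg 6 - 1, by omega⟩
          rw [hr, show primeAbove q - (τ.reg 6 + 1) = r by omega, add_mul]
          omega
        · refine ⟨_, (Runs.block ?_).seq ((Runs.cond_true ?_ (Runs.block ?_)).seq (Runs.block ?_)),
            ⟨?_, ?_, ?_, ?_, ?_, ?_, ?_, ?_, ?_, ?_, ?_⟩, ?_⟩
          all_goals
            simp at h2 h3 h4 h6 h7 h8 h9 h10 hdvd hmod h11 ht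
            simp [AllSmall, applyAll, Instr.Small, Instr.apply, Op.eval, *]
          any_goals omega
          intro j hj hj'
          rcases Nat.lt_or_eq_of_le hj' with hj' | rfl
          · exact h11 j hj hj'
          · rwa [Nat.dvd_iff_mod_eq_zero]) σ₁ hI
  refine ⟨τ, hinit.seq h1, h2, h3, h4, h5, h6, le_antisymm h8 ?_⟩
  refine Nat.find_min' _ ⟨h7, Nat.prime_def_lt'.2 ⟨by omega, fun j hj hj' => h11 j hj ?_⟩⟩
  omega

/-! ### Modular arithmetic and the accumulation of the three forms -/

theorem runs_pow {W p : ℕ} {b e r : Fin 27} {σ : State 27}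
    (hr : r ∉ [Reg.one, Reg.p, Reg.zero, b, Reg.zero, e, Reg.c])
    (hc : Reg.c ∉ [Reg.one, Reg.p, Reg.zero, b, Reg.zero, e])
    (hone : σ.reg Reg.one = 1) (hzero : σ.reg Reg.zero = 0) (hp : σ.reg Reg.p = p) (hp1 : 1 < p)
    (hb : σ.reg b < p) (he : σ.reg e ≤ W) (hW : 3 * p ^ 3 ≤ W) :
    ∃ v, Runs W (powProg b e r) σ ((σ.set r v).set Reg.c 0) ∧ v < p ∧
      (v : ZMod p) = (σ.reg b : ZMod p) ^ σ.reg e := by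
  subst hp
  obtain ⟨v, h1, h2, h3⟩ := runs_horner (W := W) (r₀ := 1) hr hc hone hzero (by omega) he hp1 (by
    rw [hzero]
    nlinarith [pow_le_pow_right₀ hp1.le (show 1 ≤ 3 by norm_num),
      pow_le_pow_right₀ hp1.le (show 2 ≤ 3 by norm_num), Nat.mul_le_mul_left (σ.reg Reg.p) hb.le])
  exact ⟨v, h1, h2, by
    rw [h3, hzero, Nat.cast_one, Nat.cast_zero, one_mul, zero_mul, add_zero]⟩

/-- Before reduction the value is at most `2 * p ^ 3 + p`; this is the source of the requirement `3
* p ^ 3 ≤ W`. -/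
theorem runs_acc {W p : ℕ} {r a b a' b' : Fin 27} {σ : State 27}
    (hr : r ∉ [Reg.p, Reg.t, Reg.t']) (ht : Reg.t ∉ [a, b, a', b']) (ht' : Reg.t' ∉ [a, b, a', b'])
    (hp : σ.reg Reg.p = p) (hp1 : 1 < p) (hm : σ.reg Reg.m < p) (hrp : σ.reg r < p)
    (ha : σ.reg a < p) (hb : σ.reg b < p) (ha' : σ.reg a' < p) (hb' : σ.reg b' < p)
    (hW : 3 * p ^ 3 ≤ W) :
    ∃ w w' v, Runs W (accProg r a b a' b') σ (((σ.set Reg.t w).set Reg.t' w').set r v) ∧ v < p ∧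
      (v : ZMod p) = σ.reg r +
        σ.reg Reg.m * (σ.reg a * σ.reg b + σ.reg a' * σ.reg b' : ZMod p) := by
  have h1 : σ.reg a * σ.reg b ≤ p ^ 2 := by rw [sq]; exact Nat.mul_le_mul ha.le hb.le
  have h2 : σ.reg a' * σ.reg b' ≤ p ^ 2 := by rw [sq]; exact Nat.mul_le_mul ha'.le hb'.le
  have h3 : (σ.reg a * σ.reg b + σ.reg a' * σ.reg b') * σ.reg Reg.m ≤ 2 * p ^ 3 := by
    calc _ ≤ (p ^ 2 + p ^ 2) * p := Nat.mul_le_mul (by omega) hm.le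
      _ = 2 * p ^ 3 := by ring
  have h4 : p ≤ p ^ 3 := Nat.le_self_pow (by norm_num) p
  have h5 : p ^ 2 ≤ p ^ 3 := Nat.pow_le_pow_right (by omega) (by norm_num)
  have h6 := Nat.mod_lt ((σ.reg a * σ.reg b + σ.reg a' * σ.reg b') * σ.reg Reg.m + σ.reg r)
    (show 0 < p by omega)
  simp only [List.mem_cons, List.not_mem_nil, or_false, not_or] at hr ht ht'
  obtain ⟨hr1, hr2, hr3⟩ := hr
  obtain ⟨ht1, ht2, ht3, ht4⟩ := ht
  obtain ⟨ht1', ht2', ht3', ht4'⟩ := ht'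
  have ne := And.intro (⟨hr1, hr2, hr3⟩ : _ ∧ _ ∧ _) <|
    And.intro (⟨Ne.symm ht1, Ne.symm ht2, Ne.symm ht3, Ne.symm ht4⟩ : _ ∧ _ ∧ _ ∧ _)
    (⟨Ne.symm ht1', Ne.symm ht2', Ne.symm ht3', Ne.symm ht4'⟩ : _ ∧ _ ∧ _ ∧ _)
  simp at ne h3 h6 hp
  refine ⟨(σ.reg a * σ.reg b + σ.reg a' * σ.reg b') * σ.reg Reg.m + σ.reg r,
    σ.reg a' * σ.reg b',
    ((σ.reg a * σ.reg b + σ.reg a' * σ.reg b') * σ.reg Reg.m + σ.reg r) % p, ?_, by simpa using h6, ?_⟩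
  · have := Runs.block (W := W) (σ := σ) (i := .arith .mul Reg.t a b)
      (is := [.arith .mul Reg.t' a' b', .arith .add Reg.t Reg.t Reg.t',
        .arith .mul Reg.t Reg.t Reg.m, .arith .add Reg.t Reg.t r, .arith .mod r Reg.t Reg.p]) (by
        simp [AllSmall, Instr.Small, Instr.apply, Op.eval, ne, hp]
        omega)
    rw [← show _ = (((σ.set Reg.t _).set Reg.t' _).set r _) from ?_]
    · exact this
    apply State.ext'
    · intro i
      by_cases hi : i = r <;> by_cases hi' : i = Reg.t <;> by_cases hi'' : i = Reg.t' <;>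
        simp at hi' hi'' <;>
        simp [applyAll, Instr.apply, Op.eval, ne, hi, hi', hi'', hp]
    · simp [applyAll, Instr.apply]
    · simp [applyAll, Instr.apply]
  · push_cast [ZMod.natCast_mod]
    ring

/-- The algorithm with modulus `p` and random point `x` holds `F`, `A` and `B` (modulo `p`) and has
not yet read the part `l` of the stream. -/
structure Holds {n : ℕ} (p x : ℕ) (F A B : ZMod p) (l : List (Item n)) (σ : State 27) : Prop where
  n_eq : σ.reg Reg.n = n
  one_eq : σ.reg Reg.one = 1
  zero_eq : σ.reg Reg.zero = 0
  p_eq : σ.reg Reg.p = p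
  x_eq : σ.reg Reg.x = x
  y_lt : σ.reg Reg.y < p
  y_eq : (σ.reg Reg.y : ZMod p) = (x : ZMod p) ^ n
  fxy_lt : σ.reg Reg.fxy < p
  fxy_eq : (σ.reg Reg.fxy : ZMod p) = F
  fx_lt : σ.reg Reg.fx < p
  fx_eq : (σ.reg Reg.fx : ZMod p) = A
  fy_lt : σ.reg Reg.fy < p
  fy_eq : (σ.reg Reg.fy : ZMod p) = B
  input_eq : σ.input = l.map Item.encode

theorem runs_diag {W n p x : ℕ} {l : List (Item n)} {σ : State 27} (hn : σ.reg Reg.n = n)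
    (hone : σ.reg Reg.one = 1) (hzero : σ.reg Reg.zero = 0) (hp : σ.reg Reg.p = p)
    (hx : σ.reg Reg.x = x) (hl : σ.input = l.map Item.encode) (hp1 : 1 < p) (hxp : x < p)
    (hnW : n ≤ W) (hW : 3 * p ^ 3 ≤ W) :
    ∃ τ, Runs W diagProg σ τ ∧ Holds p x (∑ i ∈ Finset.range n, (x * x ^ n : ZMod p) ^ i)
      ((1 - (1 - n) : ℕ) : ZMod p) ((1 - (1 - n) : ℕ) : ZMod p) l τ := by
  obtain ⟨y, h1, h2, h3⟩ := runs_pow (W := W) (σ := σ) (b := Reg.x) (e := Reg.n) (r := Reg.y)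
    (by decide) (by decide) hone hzero hp hp1 (by omega) (by omega) hW
  have h5 : x * y ≤ p ^ 2 := by rw [sq]; exact Nat.mul_le_mul hxp.le h2.le
  have h6 : p ^ 2 ≤ p ^ 3 := Nat.pow_le_pow_right (by omega) (by norm_num)
  have h7 : p ≤ p ^ 3 := Nat.le_self_pow (by norm_num) p
  have h8 : p * (x * y) ≤ p ^ 3 := by
    calc _ ≤ p * p ^ 2 := Nat.mul_le_mul_left _ h5
      _ = p ^ 3 := by ring
  rw [hx, hn] at h3
  simp at hn hone hzero hp hx
  have hd := Runs.block (W := W) (σ := (σ.set Reg.y y).set Reg.c 0)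
    (i := .arith .mul Reg.d Reg.x Reg.y) (is := []) (by
      simp [AllSmall, Instr.Small, Op.eval, hx]; omega)
  obtain ⟨f, h9, h10, h11⟩ := runs_horner (W := W) (r₀ := 0) (one := Reg.one) (p := Reg.p)
    (zero := Reg.zero) (b := Reg.d) (a := Reg.one) (e := Reg.n) (r := Reg.fxy) (c := Reg.c)
    (σ := applyAll [.arith .mul Reg.d Reg.x Reg.y] ((σ.set Reg.y y).set Reg.c 0))
    (by decide) (by decide)
    (by simp [applyAll, Instr.apply, hone]) (by simp [applyAll, Instr.apply, hzero])
    (by simp [applyAll, Instr.apply, hp]; omega) (by simp [applyAll, Instr.apply, hn, hnW])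
    (by simp [applyAll, Instr.apply, hp]; omega)
    (by simp [applyAll, Instr.apply, Op.eval, hp, hx, hone]; omega)
  refine ⟨_, h1.seq (hd.seq (h9.seq (Runs.block ?_))), ?_⟩
  · simp [AllSmall, Instr.Small, Instr.apply, Op.eval, applyAll, hone, hn, hzero]
    omega
  · have h12 : (applyAll [.arith .mul Reg.d Reg.x Reg.y] ((σ.set Reg.y y).set Reg.c 0)).reg Reg.p = p := by
      simp [applyAll, Instr.apply, hp]
    rw [h12] at h10 h11
    constructor
    all_goals try simp [Instr.apply, Op.eval, applyAll, hone, hn, hzero, hp, hx, h2, h3, hl, h10]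
    · simp [Instr.apply, Op.eval, applyAll, hone, hn, hx] at h11
      rw [h11, h3]
    all_goals omega

theorem Item.weight_eq_encode {n p : ℕ} (hp : 2 < p) (t : Item n) :
    t.encode.2.2 ≤ 1 ∧ ((p - 1 - 1) * t.encode.2.2 + 1 : ℕ) < p ∧
      (((p - 1 - 1) * t.encode.2.2 + 1 : ℕ) : ZMod p) = t.weight (ZMod p) := by
  unfold Item.encode Item.weight
  cases t.sign with
  | plus => simp; omega
  | minus =>
    refine ⟨le_rfl, by simp; omega, ?_⟩
    have : (p - 1 - 1) * 1 + 1 = p - 1 := by omega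
    simp only [this]
    rw [Nat.cast_sub (by omega)]; simp

/-- The coefficients of the edge `t` have been computed. -/
structure Prepared {n : ℕ} (p x : ℕ) (t : Item n) (σ : State 27) : Prop where
  xu_lt : σ.reg Reg.xu < p
  xu_eq : (σ.reg Reg.xu : ZMod p) = (x : ZMod p) ^ (t.u : ℕ)
  xv_lt : σ.reg Reg.xv < p
  xv_eq : (σ.reg Reg.xv : ZMod p) = (x : ZMod p) ^ (t.v : ℕ)
  yu_lt : σ.reg Reg.yu < p
  yu_eq : (σ.reg Reg.yu : ZMod p) = ((x : ZMod p) ^ n) ^ (t.u : ℕ)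
  yv_lt : σ.reg Reg.yv < p
  yv_eq : (σ.reg Reg.yv : ZMod p) = ((x : ZMod p) ^ n) ^ (t.v : ℕ)
  du_eq : σ.reg Reg.du = 1 - t.u
  dv_eq : σ.reg Reg.dv = 1 - t.v
  m_lt : σ.reg Reg.m < p
  m_eq : (σ.reg Reg.m : ZMod p) = t.weight (ZMod p)

theorem runs_prep {W n p x : ℕ} {F A B : ZMod p} {l : List (Item n)} {σ : State 27} {t : Item n}
    (h : Holds p x F A B l σ) (hu : σ.reg Reg.u = t.u) (hv : σ.reg Reg.v = t.v)
    (hs : σ.reg Reg.s = t.encode.2.2) (hp : 2 < p) (hxp : x < p) (hnW : n ≤ W)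
    (hW : 3 * p ^ 3 ≤ W) :
    ∃ τ, Runs W prepProg σ τ ∧ Holds p x F A B l τ ∧ Prepared p x t τ := by
  have hp1 : 1 < p := by omega
  have htu := t.u.2
  have htv := t.v.2
  obtain ⟨hs1, hs2, hs3⟩ := t.weight_eq_encode hp
  have hpW : p ≤ p ^ 3 := Nat.le_self_pow (by norm_num) p
  have hn := h.n_eq
  have hone := h.one_eq
  have hzero := h.zero_eq
  have hpp := h.p_eq
  have hx := h.x_eq
  have hy := h.y_lt
  have hy' := h.y_eq
  simp at hn hone hzero hpp hx hy hy' hu hv hs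
  obtain ⟨xu, r1, hxu, hxu'⟩ := runs_pow (W := W) (σ := σ) (p := p) (b := Reg.x) (e := Reg.u)
    (r := Reg.xu) (by decide) (by decide) (by simp [*]) (by simp [*]) (by simp [*]) hp1
    (by simp [*]) (by simp [*]; omega) hW
  obtain ⟨xv, r2, hxv, hxv'⟩ := runs_pow (W := W) (σ := (σ.set Reg.xu xu).set Reg.c 0) (p := p)
    (b := Reg.x) (e := Reg.v) (r := Reg.xv) (by decide) (by decide) (by simp [*]) (by simp [*])
    (by simp [*]) hp1 (by simp [*]) (by simp [*]; omega) hW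
  obtain ⟨yu, r3, hyu, hyu'⟩ := runs_pow (W := W)
    (σ := (((σ.set Reg.xu xu).set Reg.c 0).set Reg.xv xv).set Reg.c 0) (p := p)
    (b := Reg.y) (e := Reg.u) (r := Reg.yu) (by decide) (by decide) (by simp [*]) (by simp [*])
    (by simp [*]) hp1 (by simp [*]) (by simp [*]; omega) hW
  obtain ⟨yv, r4, hyv, hyv'⟩ := runs_pow (W := W)
    (σ := (((((σ.set Reg.xu xu).set Reg.c 0).set Reg.xv xv).set Reg.c 0).set Reg.yu yu).set Reg.c 0)
    (p := p) (b := Reg.y) (e := Reg.v) (r := Reg.yv) (by decide) (by decide) (by simp [*])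
    (by simp [*]) (by simp [*]) hp1 (by simp [*]) (by simp [*]; omega) hW
  refine ⟨_, r1.seq (r2.seq (r3.seq (r4.seq (Runs.block ?_)))), ?_, ?_⟩
  · simp [AllSmall, Instr.Small, Instr.apply, Op.eval, *]; omega
  · constructor
    all_goals simp [applyAll, Instr.apply]
    exacts [h.n_eq, h.one_eq, h.zero_eq, h.p_eq, h.x_eq, h.y_lt, h.y_eq, h.fxy_lt, h.fxy_eq,
      h.fx_lt, h.fx_eq, h.fy_lt, h.fy_eq, h.input_eq]
  · simp at hxu' hxv' hyu' hyv'
    rw [hx, hu] at hxu'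
    rw [hx, hv] at hxv'
    rw [hu, hy'] at hyu'
    rw [hv, hy'] at hyv'
    constructor
    all_goals simp only [applyAll, Instr.apply, Op.eval]
    -- Casts are not pushed inside, so that the value of `m` still matches `hs3`.
    all_goals simp [-Nat.cast_add, -Nat.cast_mul, *]

theorem runs_edge {W n p x : ℕ} {F A B : ZMod p} {l : List (Item n)} {σ : State 27} {t : Item n}
    (h : Holds p x F A B l σ) (hu : σ.reg Reg.u = t.u) (hv : σ.reg Reg.v = t.v)
    (hs : σ.reg Reg.s = t.encode.2.2) (hp : 2 < p) (hxp : x < p) (hnW : n ≤ W)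
    (hW : 3 * p ^ 3 ≤ W) :
    ∃ τ, Runs W edgeProg σ τ ∧ Holds p x
      (F + t.term fun u v => (x : ZMod p) ^ u * ((x : ZMod p) ^ n) ^ v)
      (A + t.term fun u v => ((1 - u : ℕ) : ZMod p) * (x : ZMod p) ^ v)
      (B + t.term fun u v => ((1 - u : ℕ) : ZMod p) * ((x : ZMod p) ^ n) ^ v) l τ := by
  have hp1 : 1 < p := by omega
  obtain ⟨τ, r, hτ, ht⟩ := runs_prep h hu hv hs hp hxp hnW hW
  obtain ⟨hn, hone, hzero, hpp, hx, hy, hy', hF, hF', hA, hA', hB, hB', hi⟩ := hτ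
  obtain ⟨hxu, hxu', hxv, hxv', hyu, hyu', hyv, hyv', hdu, hdv, hm, hm'⟩ := ht
  have hdu' : τ.reg Reg.du < p := by omega
  have hdv' : τ.reg Reg.dv < p := by omega
  simp at hn hone hzero hpp hx hy hy' hF hF' hA hA' hB hB' hxu hxu' hxv hxv' hyu hyu' hyv hyv'
  simp at hdu hdv hm hm' hdu' hdv'
  obtain ⟨w1, w1', F', r1, hF1, hF2⟩ := runs_acc (r := Reg.fxy) (a := Reg.xu) (b := Reg.yv)
    (a' := Reg.xv) (b' := Reg.yu) (by decide) (by decide) (by decide) (W := W) (p := p)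
    (σ := τ) (by simp [*]) hp1 (by simp [*]) (by simp [*]) (by simp [*]) (by simp [*])
    (by simp [*]) (by simp [*]) hW
  obtain ⟨w2, w2', A', r2, hA1, hA2⟩ := runs_acc (r := Reg.fx) (a := Reg.du) (b := Reg.xv)
    (a' := Reg.dv) (b' := Reg.xu) (by decide) (by decide) (by decide) (W := W) (p := p)
    (σ := ((τ.set Reg.t w1).set Reg.t' w1').set Reg.fxy F')
    (by simp [*]) hp1 (by simp [*]) (by simp [*]) (by simpa using hdu') (by simp [*])
    (by simpa using hdv') (by simp [*]) hW
  obtain ⟨w3, w3', B', r3, hB1, hB2⟩ := runs_acc (r := Reg.fy) (a := Reg.du) (b := Reg.yv)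
    (a' := Reg.dv) (b' := Reg.yu) (by decide) (by decide) (by decide) (W := W) (p := p)
    (σ := ((((((τ.set Reg.t w1).set Reg.t' w1').set Reg.fxy F').set Reg.t w2).set Reg.t' w2').set
      Reg.fx A'))
    (by simp [*]) hp1 (by simp [*]) (by simp [*]) (by simpa using hdu') (by simp [*])
    (by simpa using hdv') (by simp [*]) hW
  refine ⟨_, r.seq (r1.seq (r2.seq r3)), ?_⟩
  simp [hF', hA', hB', hm', hxu', hxv', hyu', hyv', hdu, hdv] at hF2 hA2 hB2
  constructor
  all_goals simp [*, Item.term]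

theorem runs_stream_loop {W n p x : ℕ} (hp : 2 < p) (hxp : x < p) (hnW : n ≤ W)
    (hW : 3 * p ^ 3 ≤ W) (l : List (Item n)) : ∀ (F A B : ZMod p) (σ : State 27),
    Holds p x F A B l σ →
    ∃ τ, Runs W streamProg σ τ ∧ Holds p x
      (F + (l.map (Item.term fun u v => (x : ZMod p) ^ u * ((x : ZMod p) ^ n) ^ v)).sum)
      (A + (l.map (Item.term fun u v => ((1 - u : ℕ) : ZMod p) * (x : ZMod p) ^ v)).sum)
      (B + (l.map (Item.term fun u v => ((1 - u : ℕ) : ZMod p) * ((x : ZMod p) ^ n) ^ v)).sum)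
      ([] : List (Item n)) τ := by
  -- Each round ends by reading the next item, so the induction is on the loop entered just after a
  -- read. Smallness of that read is carried along, as the previous round performs it.
  suffices hloop : ∀ (F A B : ZMod p) (σ : State 27), Holds p x F A B l σ →
      readInstr.Small W σ ∧
      ∃ τ, Runs W (.loop Reg.e (.seq edgeProg (.instr readInstr))) (readInstr.apply σ) τ ∧ Holds p x
      (F + (l.map (Item.term fun u v => (x : ZMod p) ^ u * ((x : ZMod p) ^ n) ^ v)).sum)
      (A + (l.map (Item.term fun u v => ((1 - u : ℕ) : ZMod p) * (x : ZMod p) ^ v)).sum)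
      (B + (l.map (Item.term fun u v => ((1 - u : ℕ) : ZMod p) * ((x : ZMod p) ^ n) ^ v)).sum)
      ([] : List (Item n)) τ by
    intro F A B σ h
    obtain ⟨h1, τ, h2, h3⟩ := hloop F A B σ h
    exact ⟨τ, (Runs.instr h1).seq h2, h3⟩
  have hpW : p ≤ p ^ 3 := Nat.le_self_pow (by norm_num) p
  induction l with
  | nil =>
    intro F A B σ h
    have hi := h.input_eq
    rw [List.map_nil] at hi
    refine ⟨⟨by omega, by simp [hi]⟩, _, Runs.loop_stop (by simp [readInstr, Instr.apply, hi]), ?_⟩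
    obtain ⟨hn, hone, hzero, hpp, hx, hy, hy', hF, hF', hA, hA', hB, hB', hi⟩ := h
    constructor
    all_goals simp [readInstr, Instr.apply, hi]
    all_goals assumption
  | cons t l ih =>
    intro F A B σ h
    have hi := h.input_eq
    rw [List.map_cons] at hi
    obtain ⟨hs1, -⟩ := t.weight_eq_encode hp
    have htu := t.u.2
    have htv := t.v.2
    have hu : t.encode.1 = t.u := rfl
    have hv : t.encode.2.1 = t.v := rfl
    have hr : Holds p x F A B l (readInstr.apply σ) := by
      obtain ⟨hn, hone, hzero, hpp, hx, hy, hy', hF, hF', hA, hA', hB, hB', -⟩ := h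
      constructor
      all_goals simp [readInstr, Instr.apply, hi]
      all_goals assumption
    obtain ⟨τ, h1, h2⟩ := runs_edge (t := t) hr (by simp [readInstr, Instr.apply, hi, hu])
      (by simp [readInstr, Instr.apply, hi, hv]) (by simp [readInstr, Instr.apply, hi]) hp hxp hnW hW
    obtain ⟨h3, ρ, h4, h5⟩ := ih _ _ _ τ h2
    refine ⟨⟨by omega, ?_⟩, ρ, .loop_step (by simp [readInstr, Instr.apply, hi])
      (h1.seq (Runs.instr h3)) h4, ?_⟩
    · simp [hi, hu, hv]; omega
    · simpa [add_assoc] using h5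

open Classical in
theorem runs_answer {W n p x : ℕ} {F A B : ZMod p} {l : List (Item n)} {σ : State 27}
    (h : Holds p x F A B l σ) (hp : 0 < p) (hW : 3 * p ^ 3 ≤ W) :
    ∃ τ, Runs W answerProg σ τ ∧ τ.reg Reg.out = if F = A * B then 1 else 0 := by
  obtain ⟨hn, hone, hzero, hpp, hx, hy, hy', hF, hF', hA, hA', hB, hB', hi⟩ := h
  simp at hone hpp hF hA hB hF' hA' hB'
  have h1 : σ.reg 11 * σ.reg 12 ≤ p * p := Nat.mul_le_mul hA.le hB.le
  have h2 : p * p ≤ p ^ 3 := by rw [← sq]; exact Nat.pow_le_pow_right hp (by norm_num)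
  have h3 : p ≤ p ^ 3 := Nat.le_self_pow (by norm_num) p
  have h4 := Nat.mod_lt (σ.reg 11 * σ.reg 12) hp
  refine ⟨_, Runs.block ?_, ?_⟩
  · simp [AllSmall, Instr.Small, Instr.apply, Op.eval, hone, hpp]
    omega
  -- All residues are reduced, so equality modulo `p` is equality of register contents.
  · have h5 : F = A * B ↔ σ.reg 10 = σ.reg 11 * σ.reg 12 % p := by
      rw [← hF', ← hA', ← hB', ← Nat.cast_mul, ZMod.natCast_eq_natCast_iff', Nat.mod_eq_of_lt hF]
    simp only [h5]
    simp [applyAll, Instr.apply, Op.eval, hone, hpp]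
    split_ifs <;> omega

/-! ### The theorem -/

/-- A bound for the numbers that the algorithm handles. -/
def maxValue (n : ℕ) : ℕ := (1000 * (n + 1) ^ 2) ^ 4

/-- Only `i = 0` survives; this matches the diagonal part of a first-row form with the initial value
of its register. -/
theorem sum_range_one_sub_mul_pow {R : Type*} [CommRing R] (n : ℕ) (x : R) :
    ∑ i ∈ Finset.range n, ((1 - i : ℕ) : R) * x ^ i = ((1 - (1 - n) : ℕ) : R) := by
  cases n with
  | zero => simp
  | succ n =>
    rw [Finset.sum_range_succ', Finset.sum_eq_zero fun i _ => by simp]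
    simp

theorem primeAbove_pow_three_le (n : ℕ) :
    3 * primeAbove (2 ^ bitCount n) ^ 3 ≤ maxValue n := by
  have h1 := primeAbove_le (2 ^ bitCount n)
  have h2 := two_pow_bitCount_le n
  have h3 : primeAbove (2 ^ bitCount n) ≤ 1000 * (n + 1) ^ 2 := by
    have : n ^ 2 + 1 ≤ (n + 1) ^ 2 := by rw [add_sq]; omega
    omega
  -- Three factors of `maxValue` bound the cube of the modulus; the fourth absorbs the constant 3.
  calc 3 * primeAbove (2 ^ bitCount n) ^ 3
      ≤ (1000 * (n + 1) ^ 2) * (1000 * (n + 1) ^ 2) ^ 3 :=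
        Nat.mul_le_mul (by have := Nat.one_le_pow 2 (n + 1) (by omega); omega) (Nat.pow_le_pow_left h3 3)
    _ = maxValue n := by unfold maxValue; ring

theorem sq_le_maxValue (n : ℕ) : 400 * n ^ 2 + 100 * n + 100 ≤ maxValue n :=
  (show _ ≤ 1000 * (n + 1) ^ 2 by nlinarith).trans (Nat.le_self_pow (by norm_num) _)

open Classical in
theorem exists_runs {n : ℕ} {G : CompleteSignedGraph (Fin n)} {l : List (Item n)}
    (h : G.IsStream l) (ω : ℕ → Bool) :
    ∃ τ, Runs (maxValue n) balanceAlg.prog (balanceAlg.init l ω) τ ∧ τ.reg balanceAlg.outReg =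
      if G.Passes (coinNumber ω (bitCount n) : ZMod (primeAbove (2 ^ bitCount n))) then 1 else 0 := by
  have hW := primeAbove_pow_three_le n
  have hW' := sq_le_maxValue n
  have hp := le_primeAbove (2 ^ bitCount n)
  have hpow : 0 < 2 ^ bitCount n := by positivity
  have hx := coinNumber_lt ω (bitCount n)
  have hpW := Nat.le_self_pow (show 3 ≠ 0 by norm_num) (primeAbove (2 ^ bitCount n))
  obtain ⟨σ₁, r1, h1, h2, h3, h4, h5, h6⟩ := runs_sample (W := maxValue n) (n := n)
    (σ := balanceAlg.init l ω) rfl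
    rfl rfl hW'
  obtain ⟨σ₂, r2, h7, h8, h9, h10, h11, h12⟩ := runs_prime (W := maxValue n) h6 h3 (by omega)
  obtain ⟨σ₃, r3, h13⟩ := runs_diag (W := maxValue n) (l := l) (h7.trans h1) h9 (h8.trans h2) h12
    (h11.trans h5) (h10.trans h4) (by omega) (hx.trans (by omega)) (by omega) hW
  obtain ⟨σ₄, r4, h14⟩ := runs_stream_loop (by omega) (hx.trans (by omega)) (by omega) hW l _ _ _ _ h13
  obtain ⟨σ₅, r5, h15⟩ := runs_answer h14 (by omega) hW
  refine ⟨σ₅, r1.seq (r2.seq (r3.seq (r4.seq r5))), h15.trans ?_⟩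
  unfold CompleteSignedGraph.Passes
  rw [h.form_eq, h.form_eq, h.form_eq, sum_range_one_sub_mul_pow, sum_range_one_sub_mul_pow]
  simp only [← mul_pow]
  rfl

theorem size_maxValue_le {n : ℕ} (hn : 2 ≤ n) :
    ((27 * ((maxValue n).size + 1) : ℕ) : ℝ) ≤ 3000 * Real.log n := by
  set L := n.size with hL
  have h1 : n + 1 ≤ 2 ^ L := Nat.lt_size_self n
  have h2 : (maxValue n).size ≤ 41 + 8 * L := by
    rw [Nat.size_le]
    calc maxValue n ≤ (2 ^ 10 * (2 ^ L) ^ 2) ^ 4 := by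
          unfold maxValue
          gcongr
          norm_num
      _ = 2 ^ (40 + 8 * L) := by ring
      _ < 2 ^ (41 + 8 * L) := Nat.pow_lt_pow_right (by norm_num) (by omega)
  have h3 : 2 ≤ L := by
    by_contra hc
    have : 2 ^ L ≤ 2 ^ 1 := Nat.pow_le_pow_right (by norm_num) (by omega)
    omega
  have h4 : 2 ^ (L - 1) ≤ n := Nat.lt_size.1 (by omega)
  have h5 : ((L - 1 : ℕ) : ℝ) * Real.log 2 ≤ Real.log n := by
    rw [← Real.log_pow]
    exact Real.log_le_log (by positivity) (by exact_mod_cast h4)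
  have h6 := Real.log_two_gt_d9
  have h7 : ((L - 1 : ℕ) : ℝ) = L - 1 := by rw [Nat.cast_sub (by omega)]; simp
  have h8 : (27 * ((maxValue n).size + 1) : ℕ) ≤ (27 * (42 + 8 * L) : ℕ) := by omega
  have h9 : ((27 * ((maxValue n).size + 1) : ℕ) : ℝ) ≤ 27 * (42 + 8 * L) := by exact_mod_cast h8
  have h10 : (2 : ℝ) ≤ L := by exact_mod_cast h3
  rw [h7] at h5
  -- As `L - 1 ≥ 1`, `27 * (42 + 8 * L) ≤ 1566 * (L - 1)`, and `1566 / log 2` is below 3000.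
  nlinarith

end SignedStream

theorem mainTheorem1 :
    ∃ (A : SignedStream.StreamAlg) (C : ℝ),
      ∀ (n : ℕ) (G : SignedStream.CompleteSignedGraph (Fin n)) (l : List (SignedStream.Item n)),
        G.IsStream l →
          (∀ ω : ℕ → Bool, ∃ (a : SignedStream.Verdict) (m : ℕ),
            A.Run l ω a m ∧ (2 ≤ n → (m : ℝ) ≤ C * Real.log n)) ∧
          (G.IsBalanced → ∀ ω : ℕ → Bool, A.Outputs l ω .balanced) ∧
          (¬ G.IsBalanced →
            99 / 100 ≤ SignedStream.coinMeasure.real {ω | A.Outputs l ω .notBalanced}) := by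
  classical
  refine ⟨SignedStream.balanceAlg, 3000, fun n G l hl => ?_⟩
  have key : ∀ ω, ∃ τ m, SignedStream.Exec SignedStream.balanceAlg.prog
      (SignedStream.balanceAlg.init l ω) τ m ∧ m ≤ 27 * ((SignedStream.maxValue n).size + 1) ∧
      τ.reg SignedStream.balanceAlg.outReg =
        if G.Passes (SignedStream.coinNumber ω (SignedStream.bitCount n) :
          ZMod (SignedStream.primeAbove (2 ^ SignedStream.bitCount n))) then 1 else 0 := by
    intro ω
    obtain ⟨τ, hτ, hout⟩ := SignedStream.exists_runs hl ω
    -- The initial registers hold only `n` and zeros, so they fit.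
    obtain ⟨-, m, hm, hm'⟩ := hτ fun i => by
      have := SignedStream.sq_le_maxValue n
      simp only [SignedStream.StreamAlg.init, Function.update_apply]
      split_ifs <;> omega
    exact ⟨τ, m, hm, hm', hout⟩
  refine ⟨fun ω => ?_, fun hG ω => ?_, fun hG => ?_⟩
  · obtain ⟨τ, m, hm, hm', -⟩ := key ω
    exact ⟨_, m, ⟨τ, hm, rfl⟩, fun hn =>
      le_trans (by exact_mod_cast hm') (SignedStream.size_maxValue_le hn)⟩
  · obtain ⟨τ, m, hm, -, hout⟩ := key ω
    rw [if_pos (hG.passes _)] at hout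
    exact ⟨m, τ, hm, by rw [hout]; rfl⟩
  · have hp := SignedStream.le_primeAbove (2 ^ SignedStream.bitCount n)
    have hpos : 0 < 2 ^ SignedStream.bitCount n := by positivity
    have : Fact (SignedStream.primeAbove (2 ^ SignedStream.bitCount n)).Prime :=
      ⟨SignedStream.prime_primeAbove _⟩
    refine SignedStream.CompleteSignedGraph.le_coinMeasure_not_passes
      (p := SignedStream.primeAbove (2 ^ SignedStream.bitCount n)) (b := SignedStream.bitCount n)
      hG (by omega) (by omega)
      (SignedStream.le_two_pow_bitCount n) fun ω hω => ?_
    obtain ⟨τ, m, hm, -, hout⟩ := key ω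
    rw [if_neg hω] at hout
    exact ⟨m, τ, hm, by rw [hout]; rfl⟩
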